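/- A straight-line program (SLP) $\mathcal S$ of a string $S$ is an acyclic context-free grammar with exactly one rule per variable, each rule being $X\to a$ ($a$ a terminal) or $X\to YZ$ ($Y,Z$ variables), whose start variable derives $S$. Its size $|\mathcal S|$ is the number of rules and $\mathrm{depth}(\mathcal S)$ is the depth of its parse tree. The Cartesian tree of a non-empty string $S$ is the unlabelled ordered binary tree whose root corresponds to the first occurrence $i$ of the smallest character of $S$, and whose left and right subtrees are the Cartesian trees of $S[1,i-1]$ and $S[i+1,n]$ (the empty string has the empty tree). Let $T$ be a binary tree, and $T(v)$ its subtree rooted at $v$. A cluster with top boundary node $v$ is either $T(v)$, or $\{v\}\cup T(w)$ for a child $w$ of $v$, or is obtained from one of these by deleting all proper descendants of some non-leaf node $u\ne v$, which is then its bottom boundary node. A top-tree of $T$ is a rooted ordered binary tree whose nodes are clusters of $T$: its root is the cluster $T$ itself; its leaves are the single edges of $T$, each labelled as a left or a right edge; each internal node is the union of its two children $A,B$, which overlap in exactly one node, this node being either the top boundary node of both (horizontal merge, with $A$ to the left of $B$) or the top boundary node of $A$ and the bottom boundary node of $B$ (vertical merge). Internal nodes are labelled by the kind of merge (horizontal or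 vertical, and which child, if any, provides the bottom boundary node of the merged cluster). The top-tree compression $\mathcal T$ of $T$ given by a top-tree is the DAG obtained by identifying equal labelled subtrees of the top-tree; its size $|\mathcal T|$ is the number of nodes of the DAG (the number of distinct subtrees), and its depth is the depth of the top-tree. Theorem. There is an absolute constant $c>0$ such that for every $\sigma\ge 2$, every string $S$ of length $n\ge 2$ over the alphabet $\{0,\dots,\sigma-1\}$ and every SLP $\mathcal S$ of $S$, there is a top-tree compression $\mathcal T$ of the Cartesian tree of $S$ with $$|\mathcal T|\le c\cdot|\mathcal S|\cdot\sigma\qquad\text{and}\qquad \mathrm{depth}(\mathcal T)\le c\cdot\mathrm{depth}(\mathcal S)\cdot\log\sigma .$$ -/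

import Mathlib

/-! ### Straight-line programs -/

/-- A straight-line program over the alphabet `α`: a grammar with exactly one rule for each of its
`size` variables, each rule being either a single terminal or the concatenation of two variables.
Acyclicity is expressed by listing the variables in a topological order. -/
structure SLP (α : Type*) where
  /-- the number of variables, which is the number of rules -/
  size : ℕ
  /-- the right-hand side of the rule of each variable -/
  rule : Fin size → α ⊕ (Fin size × Fin size)
  /-- the start variable -/
  start : Fin size
  acyclic : ∀ i j k, rule i = Sum.inr (j, k) → j < i ∧ k < i

namespace SLP

variable {α : Type*}

/-- The string derived by a variable. -/
def word (G : SLP α) (i : Fin G.size) : List α :=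
  match h : G.rule i with
  | Sum.inl a => [a]
  | Sum.inr (j, k) =>
    have := G.acyclic i j k h
    G.word j ++ G.word k
termination_by i.val
decreasing_by
  · exact this.1
  · exact this.2

/-- The height (number of edges on a longest path from the root to a leaf) of the parse tree of a
variable; the leaves of a parse tree are the terminals. -/
def height (G : SLP α) (i : Fin G.size) : ℕ :=
  match h : G.rule i with
  | Sum.inl _ => 1
  | Sum.inr (j, k) =>
    have := G.acyclic i j k h
    max (G.height j) (G.height k) + 1
termination_by i.val
decreasing_by
  · exact this.1
  · exact this.2

/-- `G` is a straight-line program of the string `S`. -/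
def Generates (G : SLP α) (S : List α) : Prop := G.word G.start = S

/-- The depth of a straight-line program is the depth of its parse tree. -/
def depth (G : SLP α) : ℕ := G.height G.start

end SLP

/-! ### The Cartesian tree -/

/-- The Cartesian tree of a string, as an unlabelled ordered binary tree: the root is the first
occurrence of the smallest character. -/
def cartesianTree {α : Type*} [LinearOrder α] (S : List α) : BinaryTree Unit :=
  if h : S = [] then BinaryTree.nil
  else
    have := List.idxOf_lt_length_of_mem (List.min_mem h)
    BinaryTree.node ()
      (cartesianTree (S.take (S.idxOf (S.min h))))
      (cartesianTree (S.drop (S.idxOf (S.min h) + 1)))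
termination_by S.length
decreasing_by
  · simp only [List.length_take]; omega
  · simp only [List.length_drop]; omega

/-! ### Nodes and clusters of a binary tree

A node of a binary tree is addressed by the path leading to it from the root, `false` standing for
a step to the left child and `true` for a step to the right child. Thus the children of `v` are
`v ++ [false]` and `v ++ [true]`, and `u` is an ancestor of `w` (or equal to it) iff `u <+: w`. -/

/-- The set of nodes of a binary tree. -/
def treeNodes : BinaryTree Unit → Set (List Bool)
  | BinaryTree.nil => ∅
  | BinaryTree.node _ l r =>
    {[]} ∪ List.cons false '' treeNodes l ∪ List.cons true '' treeNodes r

/-- The set of nodes of the subtree `T(v)` of `T` rooted at `v`. -/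
def subtreeNodes (T : BinaryTree Unit) (v : List Bool) : Set (List Bool) :=
  {w | w ∈ treeNodes T ∧ v <+: w}

/-- `IsCluster T X v b`: the set `X` of nodes is (the node set of) a cluster of `T` with top
boundary node `v`, and `b` is its bottom boundary node, if it has one. A bottom boundary node is
required to have children in `T`, so that it has neighbours outside the cluster. -/
inductive IsCluster (T : BinaryTree Unit) :
    Set (List Bool) → List Bool → Option (List Bool) → Prop
  | whole (v : List Bool) (hv : v ∈ treeNodes T) : IsCluster T (subtreeNodes T v) v none
  | side (v : List Bool) (d : Bool) (hv : v ++ [d] ∈ treeNodes T) :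
      IsCluster T ({v} ∪ subtreeNodes T (v ++ [d])) v none
  | cut (X : Set (List Bool)) (v u : List Bool) (hX : IsCluster T X v none) (hu : u ∈ X)
      (huv : u ≠ v) (d : Bool) (hd : u ++ [d] ∈ treeNodes T) :
      IsCluster T (X \ {w | u <+: w ∧ w ≠ u}) v (some u)

/-! ### Top-trees -/

/-- The labelled ordered binary trees that can occur as top-trees. A leaf is labelled as a left
edge (`edge false`) or a right edge (`edge true`). An internal node is labelled as a horizontal or
a vertical merge, together with the kind of the merge: for a horizontal merge, whether the left and
the right child have a bottom boundary node; for a vertical merge, whether the lower cluster, which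
is the left child, has one. Hence the labelled tree determines the tree it decomposes. -/
inductive TopTree : Type
  | edge (d : Bool) : TopTree
  | horizontal (leftBottom rightBottom : Bool) (left right : TopTree) : TopTree
  | vertical (lowerBottom : Bool) (lower upper : TopTree) : TopTree
  deriving DecidableEq

/-- `Decomposes T 𝒯 X v b`: `𝒯` describes a way to build the cluster of `T` with node set `X`, top
boundary node `v` and bottom boundary node `b` (if any) from single edges of `T` by merging two
clusters that overlap in a single node whenever their union is again a cluster. -/
inductive Decomposes (T : BinaryTree Unit) :
    TopTree → Set (List Bool) → List Bool → Option (List Bool) → Prop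
  | edge (v : List Bool) (d : Bool) (b : Option (List Bool)) (hv : v ++ [d] ∈ treeNodes T)
      (h : IsCluster T {v, v ++ [d]} v b) :
      Decomposes T (TopTree.edge d) {v, v ++ [d]} v b
  | horizontal (A B : TopTree) (X Y : Set (List Bool)) (v : List Bool)
      (bA bB b : Option (List Bool))
      (hA : Decomposes T A X v bA) (hB : Decomposes T B Y v bB)
      (hXY : X ∩ Y = {v}) (hl : v ++ [false] ∈ X) (hr : v ++ [true] ∈ Y)
      (h : IsCluster T (X ∪ Y) v b) :
      Decomposes T (TopTree.horizontal bA.isSome bB.isSome A B) (X ∪ Y) v b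
  | vertical (A B : TopTree) (X Y : Set (List Bool)) (u v : List Bool)
      (bA b : Option (List Bool))
      (hA : Decomposes T A X u bA) (hB : Decomposes T B Y v (some u))
      (hXY : X ∩ Y = {u})
      (h : IsCluster T (X ∪ Y) v b) :
      Decomposes T (TopTree.vertical bA.isSome A B) (X ∪ Y) v b

namespace TopTree

/-- `𝒯` is a top-tree of `T`: its root is the cluster consisting of all of `T`. -/
def IsTopTreeOf (𝒯 : TopTree) (T : BinaryTree Unit) : Prop :=
  Decomposes T 𝒯 (treeNodes T) [] none

/-- The depth of a top-tree, which is also the depth of its DAG compression. -/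
def depth : TopTree → ℕ
  | edge _ => 0
  | horizontal _ _ A B => max A.depth B.depth + 1
  | vertical _ A B => max A.depth B.depth + 1

/-- The distinct (labelled, ordered) rooted subtrees of a top-tree. They are the nodes of its DAG
compression. -/
def subtrees : TopTree → Finset TopTree
  | edge d => {edge d}
  | horizontal p q A B => insert (horizontal p q A B) (A.subtrees ∪ B.subtrees)
  | vertical p A B => insert (vertical p A B) (A.subtrees ∪ B.subtrees)

/-- The size of the top-tree compression given by a top-tree: the number of nodes of the DAG
compression of the top-tree. -/
def dagSize (𝒯 : TopTree) : ℕ := 𝒯.subtrees.card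

end TopTree

/-! ### Cluster shapes -/

/-! The Cartesian tree of `uw` differs from those of `u` and `w` only along their spines. Write a
word as `flatL l ++ m :: flatR r`, where `m` is the first minimum, `l` lists the left spine with its
hanging blocks (characters strictly decreasing in string order) and `r` the right spine (characters
weakly increasing). Group each spine by character into at most `σ` runs. The invariant
`SpinesAvailable` asks that, for every run, the clusters of the run be already present in a common
stock of top-trees.

Concatenation encloses one part of the right spine of `u` and one part of the left spine of `w` in a
new hanging block `Z`. All other runs survive, except that at most one is extended by `Z` and joined
to another. The Cartesian tree of `Z` is a single zigzag path in which the enclosed runs alternate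
by increasing character (`cartesianTree_flatR_append_flatL`). It thus consists of at most `2σ`
available runs, and merging them in a balanced way (`run_flatten`) costs `O(σ)` new top-trees and
`O(log σ)` depth. `SpinesAvailable.append` pays this price once per rule, and `SLP.exists_stock`
sums over the grammar: stock sizes add over rules, depths only along the parse tree. A last merge of
the two spines at the root gives the top-tree (`SpinesAvailable.exists_closed`).

Sharing in the DAG requires that one top-tree serve all occurrences of a shape. Hence
`DecomposesClosed` and `DecomposesOpen` quantify over all host trees and positions. A run stops
before its last edge because that edge leads to a node not yet known, and possibly to none. It
therefore keeps separately the cluster hanging at its last node. Both open and closed versions of a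
path are stored, since the lower end may or may not acquire descendants and the merge labels differ.
-/

/-- The binary tree whose root has the subtree `x` in direction `d` and `y` in the other one. -/
def branch (d : Bool) (x y : BinaryTree Unit) : BinaryTree Unit :=
  if d then BinaryTree.node () y x else BinaryTree.node () x y

/-- The binary tree with a single node. -/
def leafTree : BinaryTree Unit := BinaryTree.node () BinaryTree.nil BinaryTree.nil

/-- Hang `t` below a path. Each step of the path is given by its direction and the subtree hanging
off in the other direction. -/
def plug : List (Bool × BinaryTree Unit) → BinaryTree Unit → BinaryTree Unit
  | [], t => t
  | (d, s) :: p, t => branch d (plug p t) s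

/-- The address of the lower end of a path. -/
def dirs (p : List (Bool × BinaryTree Unit)) : List Bool := p.map Prod.fst

/-- The subtree rooted at a given address, empty if there is no such node. -/
def subtreeAt : BinaryTree Unit → List Bool → BinaryTree Unit
  | t, [] => t
  | BinaryTree.nil, _ :: _ => BinaryTree.nil
  | BinaryTree.node _ l r, d :: w => subtreeAt (if d then r else l) w

theorem plug_append (p q : List (Bool × BinaryTree Unit)) (t : BinaryTree Unit) :
    plug (p ++ q) t = plug p (plug q t) := by
  induction p with
  | nil => rfl
  | cons a p ih => obtain ⟨d, s⟩ := a; simp [plug, ih]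

theorem branch_not (d : Bool) (x y : BinaryTree Unit) : branch (!d) x y = branch d y x := by
  cases d <;> rfl

theorem branch_ne_nil (d : Bool) (x y : BinaryTree Unit) : branch d x y ≠ BinaryTree.nil := by
  cases d <;> simp [branch]

theorem branch_nil_nil (d : Bool) : branch d BinaryTree.nil BinaryTree.nil = leafTree := by
  cases d <;> rfl

theorem treeNodes_branch (d : Bool) (x y : BinaryTree Unit) :
    treeNodes (branch d x y) = {[]} ∪ List.cons d '' treeNodes x ∪ List.cons (!d) '' treeNodes y := by
  cases d
  · simp [branch, treeNodes]
  · simp only [branch, treeNodes, if_true, Bool.not_true]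
    rw [Set.union_assoc, Set.union_assoc, Set.union_comm (List.cons false '' _)]

theorem treeNodes_leafTree : treeNodes leafTree = {[]} := by
  simp [leafTree, treeNodes]

theorem nil_mem_treeNodes {t : BinaryTree Unit} (h : t ≠ BinaryTree.nil) : [] ∈ treeNodes t := by
  cases t with
  | nil => exact absurd rfl h
  | node a l r => simp [treeNodes]

theorem plug_ne_nil {p : List (Bool × BinaryTree Unit)} {t : BinaryTree Unit}
    (h : t ≠ BinaryTree.nil) : plug p t ≠ BinaryTree.nil := by
  cases p with
  | nil => exact h
  | cons a p => exact branch_ne_nil _ _ _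

theorem subtreeAt_branch_cons (d : Bool) (x y : BinaryTree Unit) (w : List Bool) :
    subtreeAt (branch d x y) (d :: w) = subtreeAt x w := by
  cases d <;> simp [branch, subtreeAt]

theorem subtreeAt_nil (w : List Bool) : subtreeAt BinaryTree.nil w = BinaryTree.nil := by
  cases w <;> rfl

theorem subtreeAt_append (T : BinaryTree Unit) (v w : List Bool) :
    subtreeAt T (v ++ w) = subtreeAt (subtreeAt T v) w := by
  induction v generalizing T with
  | nil => cases T <;> rfl
  | cons d v ih =>
    cases T with
    | nil => simp [subtreeAt_nil]
    | node a l r => simp [subtreeAt, ih]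

theorem mem_treeNodes_iff (T : BinaryTree Unit) (w : List Bool) :
    w ∈ treeNodes T ↔ subtreeAt T w ≠ BinaryTree.nil := by
  induction w generalizing T with
  | nil => cases T <;> simp [treeNodes, subtreeAt]
  | cons d w ih =>
    cases T with
    | nil => simp [treeNodes, subtreeAt]
    | node a l r => cases d <;> simp [treeNodes, subtreeAt, ih]

theorem append_mem_treeNodes_iff (T : BinaryTree Unit) (v w : List Bool) :
    v ++ w ∈ treeNodes T ↔ w ∈ treeNodes (subtreeAt T v) := by
  simp [mem_treeNodes_iff, subtreeAt_append]

theorem subtreeNodes_eq (T : BinaryTree Unit) (v : List Bool) :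
    subtreeNodes T v = (v ++ ·) '' treeNodes (subtreeAt T v) := by
  ext w
  simp only [subtreeNodes, Set.mem_ofPred_eq, Set.mem_image]
  constructor
  · rintro ⟨hw, u, rfl⟩
    exact ⟨u, (append_mem_treeNodes_iff T v u).1 hw, rfl⟩
  · rintro ⟨u, hu, rfl⟩
    exact ⟨(append_mem_treeNodes_iff T v u).2 hu, List.prefix_append v u⟩

theorem subtreeAt_plug (p : List (Bool × BinaryTree Unit)) (t : BinaryTree Unit) :
    subtreeAt (plug p t) (dirs p) = t := by
  induction p with
  | nil => cases t <;> rfl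
  | cons a p ih =>
    obtain ⟨d, s⟩ := a
    simpa [plug, dirs, subtreeAt_branch_cons] using ih

/-- Hanging `leafTree` below `p` represents the path cluster including its lower end. This
splitting, together with the intersection and difference formulas below, is the set-theoretic
content of vertical merges and of cutting at a bottom boundary node. -/
theorem treeNodes_plug (p : List (Bool × BinaryTree Unit)) {t : BinaryTree Unit}
    (ht : t ≠ BinaryTree.nil) :
    treeNodes (plug p t) = treeNodes (plug p leafTree) ∪ (dirs p ++ ·) '' treeNodes t := by
  induction p with
  | nil =>
    simp only [plug, treeNodes_leafTree, dirs, List.map_nil, List.nil_append, Set.image_id']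
    rw [Set.union_eq_right.2]
    simpa using nil_mem_treeNodes ht
  | cons a p ih =>
    obtain ⟨d, s⟩ := a
    have h : ((dirs ((d, s) :: p)) ++ ·) = List.cons d ∘ (dirs p ++ ·) := by
      funext w; simp [dirs]
    simp only [plug, treeNodes_branch, ih, h, Set.image_comp, Set.image_union]
    ext w
    simp only [Set.mem_union]
    tauto

theorem append_mem_treeNodes_plug_leafTree (p : List (Bool × BinaryTree Unit)) (w : List Bool) :
    dirs p ++ w ∈ treeNodes (plug p leafTree) ↔ w = [] := by
  rw [append_mem_treeNodes_iff, subtreeAt_plug, treeNodes_leafTree, Set.mem_singleton_iff]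

theorem treeNodes_plug_inter (p : List (Bool × BinaryTree Unit)) {t : BinaryTree Unit}
    (ht : t ≠ BinaryTree.nil) :
    (dirs p ++ ·) '' treeNodes t ∩ treeNodes (plug p leafTree) = {dirs p} := by
  ext w
  simp only [Set.mem_inter_iff, Set.mem_image, Set.mem_singleton_iff]
  constructor
  · rintro ⟨⟨u, -, rfl⟩, h⟩
    rw [append_mem_treeNodes_plug_leafTree] at h
    simp [h]
  · rintro rfl
    exact ⟨⟨[], nil_mem_treeNodes ht, by simp⟩, by
      simpa using (append_mem_treeNodes_plug_leafTree p []).2 rfl⟩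

theorem treeNodes_plug_diff (p : List (Bool × BinaryTree Unit)) {t : BinaryTree Unit}
    (ht : t ≠ BinaryTree.nil) :
    treeNodes (plug p t) \ {w | dirs p <+: w ∧ w ≠ dirs p} = treeNodes (plug p leafTree) := by
  rw [treeNodes_plug p ht]
  ext w
  simp only [Set.mem_sdiff, Set.mem_union, Set.mem_image, Set.mem_ofPred_eq, not_and, not_not]
  constructor
  · rintro ⟨h | ⟨u, -, rfl⟩, h'⟩
    · exact h
    · rw [append_mem_treeNodes_plug_leafTree]
      simpa using h' (List.prefix_append _ _)
  · rintro h
    refine ⟨Or.inl h, ?_⟩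
    rintro ⟨u, rfl⟩
    rw [append_mem_treeNodes_plug_leafTree] at h
    simp [h]

theorem append_left_injective' (v : List Bool) : Function.Injective (v ++ ·) :=
  fun _ _ h => List.append_cancel_left h

/-- The root of `t` has a child. -/
def HasChild (t : BinaryTree Unit) : Prop := ∃ d, [d] ∈ treeNodes t

theorem HasChild.ne_nil {t : BinaryTree Unit} (h : HasChild t) : t ≠ BinaryTree.nil := by
  rintro rfl
  obtain ⟨d, hd⟩ := h
  simp [treeNodes] at hd

theorem hasChild_branch (d : Bool) {x : BinaryTree Unit} (y : BinaryTree Unit)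
    (hx : x ≠ BinaryTree.nil) : HasChild (branch d x y) := by
  refine ⟨d, ?_⟩
  rw [treeNodes_branch]
  exact Or.inl (Or.inr ⟨[], nil_mem_treeNodes hx, rfl⟩)

theorem hasChild_plug {p : List (Bool × BinaryTree Unit)} {t : BinaryTree Unit} (hp : p ≠ [])
    (ht : t ≠ BinaryTree.nil) : HasChild (plug p t) := by
  cases p with
  | nil => exact absurd rfl hp
  | cons a p => exact hasChild_branch _ _ (plug_ne_nil ht)

/-- `t` is the whole tree `s`, or consists of its root and one of the subtrees of the root. -/
def Fits (t s : BinaryTree Unit) : Prop :=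
  t = s ∨ ∃ d x y, x ≠ BinaryTree.nil ∧ t = branch d x BinaryTree.nil ∧ s = branch d x y

theorem branch_inj {d : Bool} {x y x' y' : BinaryTree Unit} :
    branch d x y = branch d x' y' ↔ x = x' ∧ y = y' := by
  cases d <;> simp [branch, and_comm]

/-- A tree with two nonempty subtrees of the root fits only itself. -/
theorem Fits.eq_of_branch {d : Bool} {x y s : BinaryTree Unit} (hx : x ≠ BinaryTree.nil)
    (hy : y ≠ BinaryTree.nil) (h : Fits (branch d x y) s) : s = branch d x y := by
  rcases h with h | ⟨e, x', y', -, h, -⟩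
  · exact h.symm
  · by_cases hde : e = d
    · subst hde
      exact absurd (branch_inj.1 h).2 hy
    · have : e = !d := by cases d <;> cases e <;> simp_all
      subst this
      rw [branch_not] at h
      exact absurd (branch_inj.1 h).1 hx

/-- Discarding one child subtree of the root leaves everything below the other child intact, so
lower clusters are always whole subtrees of the host. -/
theorem Fits.subtreeAt_cons {d : Bool} {x y s : BinaryTree Unit} (hx : x ≠ BinaryTree.nil)
    (h : Fits (branch d x y) s) (w : List Bool) : subtreeAt s (d :: w) = subtreeAt x w := by
  rcases h with rfl | ⟨e, x', y', -, h, rfl⟩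
  · exact subtreeAt_branch_cons ..
  · by_cases hde : e = d
    · subst hde
      rw [(branch_inj.1 h).1, subtreeAt_branch_cons]
    · have : e = !d := by cases d <;> cases e <;> simp_all
      subst this
      rw [branch_not] at h
      exact absurd (branch_inj.1 h).1 hx

theorem Fits.subtreeAt_dirs {p : List (Bool × BinaryTree Unit)} {t s : BinaryTree Unit}
    (hp : p ≠ []) (ht : t ≠ BinaryTree.nil) (h : Fits (plug p t) s) :
    subtreeAt s (dirs p) = t := by
  cases p with
  | nil => exact absurd rfl hp
  | cons a p =>
    obtain ⟨d, x⟩ := a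
    exact (h.subtreeAt_cons (plug_ne_nil ht) _).trans (subtreeAt_plug p t)

theorem Fits.ne_nil {t s : BinaryTree Unit} (ht : t ≠ BinaryTree.nil) (h : Fits t s) :
    s ≠ BinaryTree.nil := by
  rcases h with rfl | ⟨d, x, y, -, -, rfl⟩
  · exact ht
  · exact branch_ne_nil d x y

theorem Fits.isCluster {T t : BinaryTree Unit} {v : List Bool} (ht : t ≠ BinaryTree.nil)
    (h : Fits t (subtreeAt T v)) : IsCluster T ((v ++ ·) '' treeNodes t) v none := by
  have hv : v ∈ treeNodes T := (mem_treeNodes_iff T v).2 (h.ne_nil ht)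
  rcases h with rfl | ⟨d, x, y, hx, rfl, h⟩
  · rw [← subtreeNodes_eq]
    exact IsCluster.whole v hv
  · have hx' : subtreeAt T (v ++ [d]) = x := by
      rw [subtreeAt_append, h, subtreeAt_branch_cons]; cases x <;> rfl
    have := IsCluster.side (T := T) v d ((mem_treeNodes_iff _ _).2 (hx' ▸ hx))
    convert this using 1
    rw [subtreeNodes_eq, hx', treeNodes_branch]
    simp only [treeNodes, Set.image_empty, Set.union_empty, Set.image_union, Set.image_singleton,
      List.append_nil, Set.image_image, List.append_assoc, List.singleton_append]

/-- Cut the closed cluster of `plug p x` at the lower end of `p`. A child of the root of `x` is what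
entitles that node to be a bottom boundary node. -/
theorem Fits.isCluster_plug {T x : BinaryTree Unit} {p : List (Bool × BinaryTree Unit)}
    {v : List Bool} (hp : p ≠ []) (hx : HasChild x) (h : Fits (plug p x) (subtreeAt T v)) :
    IsCluster T ((v ++ ·) '' treeNodes (plug p leafTree)) v (some (v ++ dirs p)) := by
  obtain ⟨d, hd⟩ := hx
  have hx' : x ≠ BinaryTree.nil := HasChild.ne_nil ⟨d, hd⟩
  have hsub : subtreeAt T (v ++ dirs p) = x := by
    rw [subtreeAt_append, h.subtreeAt_dirs hp hx']
  have := IsCluster.cut (T := T) _ v (v ++ dirs p) (h.isCluster (plug_ne_nil hx'))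
    ⟨dirs p, by
      rw [treeNodes_plug p hx']
      exact Or.inr ⟨[], nil_mem_treeNodes hx', by simp⟩, rfl⟩
    (by simpa [dirs] using hp) d (by rw [append_mem_treeNodes_iff, hsub]; exact hd)
  convert this using 1
  rw [← treeNodes_plug_diff p hx', Set.image_sdiff (append_left_injective' v)]
  ext w
  simp only [Set.mem_sdiff, Set.mem_image, Set.mem_ofPred_eq]
  constructor
  · rintro ⟨⟨u, hu, rfl⟩, h2⟩
    refine ⟨⟨u, hu, rfl⟩, ?_⟩
    rintro ⟨h3, h4⟩
    exact h2 ⟨u, ⟨(List.prefix_append_right_inj v).1 h3, fun h => h4 (by rw [h])⟩, rfl⟩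
  · rintro ⟨⟨u, hu, rfl⟩, h2⟩
    refine ⟨⟨u, hu, rfl⟩, ?_⟩
    rintro ⟨u', ⟨h3, h4⟩, h5⟩
    obtain rfl := append_left_injective' v h5
    exact h2 ⟨(List.prefix_append_right_inj v).2 h3, fun h => h4 (append_left_injective' v h)⟩

/-! ### Top-trees of cluster shapes -/

/-- `A` decomposes every cluster of shape `t` without bottom boundary node. -/
def DecomposesClosed (A : TopTree) (t : BinaryTree Unit) : Prop :=
  HasChild t ∧ ∀ (T : BinaryTree Unit) (v : List Bool), Fits t (subtreeAt T v) →
    Decomposes T A ((v ++ ·) '' treeNodes t) v none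

/-- `A` decomposes every cluster that consists of the path `p`, its lower end being the bottom
boundary node, and the subtrees hanging off it. -/
def DecomposesOpen (A : TopTree) (p : List (Bool × BinaryTree Unit)) : Prop :=
  p ≠ [] ∧ ∀ (T : BinaryTree Unit) (v : List Bool) (x : BinaryTree Unit), HasChild x →
    Fits (plug p x) (subtreeAt T v) →
    Decomposes T A ((v ++ ·) '' treeNodes (plug p leafTree)) v (some (v ++ dirs p))

theorem image_edge (v : List Bool) (d : Bool) :
    (v ++ ·) '' treeNodes (branch d leafTree BinaryTree.nil) = {v, v ++ [d]} := by
  rw [treeNodes_branch, treeNodes_leafTree]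
  simp [treeNodes, Set.image_pair, Set.pair_comm]

theorem leafTree_ne_nil : leafTree ≠ BinaryTree.nil := by simp [leafTree]

theorem decomposesClosed_edge (d : Bool) :
    DecomposesClosed (TopTree.edge d) (branch d leafTree BinaryTree.nil) := by
  refine ⟨hasChild_branch _ _ leafTree_ne_nil, fun T v h => ?_⟩
  have hc := h.isCluster (branch_ne_nil _ _ _)
  rw [image_edge] at hc ⊢
  refine Decomposes.edge v d none ?_ hc
  rw [append_mem_treeNodes_iff, mem_treeNodes_iff, h.subtreeAt_cons leafTree_ne_nil]
  exact leafTree_ne_nil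

theorem decomposesOpen_edge (d : Bool) : DecomposesOpen (TopTree.edge d) [(d, BinaryTree.nil)] := by
  refine ⟨by simp, fun T v x hx h => ?_⟩
  have hc := h.isCluster_plug (by simp) hx
  simp only [plug, dirs, List.map_cons, List.map_nil] at h hc ⊢
  rw [image_edge] at hc ⊢
  refine Decomposes.edge v d _ ?_ hc
  rw [append_mem_treeNodes_iff, mem_treeNodes_iff, h.subtreeAt_cons hx.ne_nil, subtreeAt]
  exact hx.ne_nil

theorem image_branch_union (v : List Bool) (d : Bool) (x y : BinaryTree Unit) :
    (v ++ ·) '' treeNodes (branch d x BinaryTree.nil) ∪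
      (v ++ ·) '' treeNodes (branch (!d) y BinaryTree.nil) =
    (v ++ ·) '' treeNodes (branch d x y) := by
  rw [← Set.image_union]
  congr 1
  simp only [treeNodes_branch, treeNodes, Set.image_empty, Set.union_empty]
  ext w
  simp only [Set.mem_union]
  tauto

theorem image_branch_inter (v : List Bool) (d : Bool) (x y : BinaryTree Unit) :
    (v ++ ·) '' treeNodes (branch d x BinaryTree.nil) ∩
      (v ++ ·) '' treeNodes (branch (!d) y BinaryTree.nil) = {v} := by
  rw [← Set.image_inter (append_left_injective' v)]
  have : treeNodes (branch d x BinaryTree.nil) ∩ treeNodes (branch (!d) y BinaryTree.nil) =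
      {[]} := by
    simp only [treeNodes_branch, treeNodes, Set.image_empty, Set.union_empty]
    ext w
    cases w with
    | nil => simp
    | cons e w => cases d <;> cases e <;> simp
  rw [this]
  simp

theorem mem_image_branch (v : List Bool) (d : Bool) {x : BinaryTree Unit} (y : BinaryTree Unit)
    (hx : x ≠ BinaryTree.nil) : v ++ [d] ∈ (v ++ ·) '' treeNodes (branch d x y) := by
  refine ⟨[d], ?_, rfl⟩
  rw [treeNodes_branch]
  exact Or.inl (Or.inr ⟨[], nil_mem_treeNodes hx, rfl⟩)

theorem HasChild.of_branch {d : Bool} {x : BinaryTree Unit}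
    (h : HasChild (branch d x BinaryTree.nil)) : x ≠ BinaryTree.nil := by
  rintro rfl
  obtain ⟨e, he⟩ := h
  rw [branch_nil_nil, treeNodes_leafTree] at he
  simp at he

theorem decomposesClosed_horizontal {A B : TopTree} {l r : BinaryTree Unit}
    (hA : DecomposesClosed A (branch false l BinaryTree.nil))
    (hB : DecomposesClosed B (branch true r BinaryTree.nil)) :
    DecomposesClosed (TopTree.horizontal false false A B) (branch false l r) := by
  have hl := hA.1.of_branch
  have hr := hB.1.of_branch
  refine ⟨hasChild_branch _ _ hl, fun T v h => ?_⟩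
  -- With both root subtrees nonempty the cluster is the whole subtree at `v`, so each half is a
  -- legitimate one-child cluster there.
  have hs := h.eq_of_branch hl hr
  have hc := h.isCluster (branch_ne_nil _ _ _)
  rw [← image_branch_union] at hc ⊢
  exact Decomposes.horizontal A B _ _ v none none none
    (hA.2 T v (Or.inr ⟨false, l, r, hl, rfl, hs⟩))
    (hB.2 T v (Or.inr ⟨true, r, l, hr, rfl, hs⟩))
    (image_branch_inter v false l r) (mem_image_branch _ _ _ hl) (mem_image_branch _ _ _ hr) hc

theorem decomposesOpen_horizontal_left {A B : TopTree} {p : List (Bool × BinaryTree Unit)}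
    {r : BinaryTree Unit} (hA : DecomposesOpen A ((false, BinaryTree.nil) :: p))
    (hB : DecomposesClosed B (branch true r BinaryTree.nil)) :
    DecomposesOpen (TopTree.horizontal true false A B) ((false, r) :: p) := by
  have hr := hB.1.of_branch
  refine ⟨by simp, fun T v x hx h => ?_⟩
  have hl : plug p x ≠ BinaryTree.nil := plug_ne_nil hx.ne_nil
  have hl' : plug p leafTree ≠ BinaryTree.nil := plug_ne_nil leafTree_ne_nil
  have hs := h.eq_of_branch hl hr
  have hc := h.isCluster_plug (by simp) hx
  simp only [plug] at hc ⊢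
  rw [← image_branch_union] at hc ⊢
  exact Decomposes.horizontal A B _ _ v (some _) none _
    (hA.2 T v x hx (Or.inr ⟨false, _, r, hl, rfl, hs⟩))
    (hB.2 T v (Or.inr ⟨true, r, _, hr, rfl, hs⟩))
    (image_branch_inter v false _ r) (mem_image_branch _ _ _ hl') (mem_image_branch _ _ _ hr) hc

theorem decomposesOpen_horizontal_right {A B : TopTree} {p : List (Bool × BinaryTree Unit)}
    {l : BinaryTree Unit} (hA : DecomposesClosed A (branch false l BinaryTree.nil))
    (hB : DecomposesOpen B ((true, BinaryTree.nil) :: p)) :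
    DecomposesOpen (TopTree.horizontal false true A B) ((true, l) :: p) := by
  have hl := hA.1.of_branch
  refine ⟨by simp, fun T v x hx h => ?_⟩
  have hr : plug p x ≠ BinaryTree.nil := plug_ne_nil hx.ne_nil
  have hr' : plug p leafTree ≠ BinaryTree.nil := plug_ne_nil leafTree_ne_nil
  have hs := h.eq_of_branch hr hl
  have hc := h.isCluster_plug (by simp) hx
  simp only [plug] at hc ⊢
  rw [← branch_not true, Bool.not_true, ← image_branch_union] at hc ⊢
  exact Decomposes.horizontal A B _ _ v none (some _) _
    (hA.2 T v (Or.inr ⟨false, l, _, hl, rfl, hs⟩))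
    (hB.2 T v x hx (Or.inr ⟨true, _, l, hr, rfl, hs⟩))
    (image_branch_inter v false l _) (mem_image_branch _ _ _ hl) (mem_image_branch _ _ _ hr') hc

theorem image_plug_union (v : List Bool) (p : List (Bool × BinaryTree Unit))
    {t : BinaryTree Unit} (ht : t ≠ BinaryTree.nil) :
    (v ++ dirs p ++ ·) '' treeNodes t ∪ (v ++ ·) '' treeNodes (plug p leafTree) =
      (v ++ ·) '' treeNodes (plug p t) := by
  rw [treeNodes_plug p ht, Set.image_union, Set.image_image, Set.union_comm]
  simp only [List.append_assoc]

theorem image_plug_inter (v : List Bool) (p : List (Bool × BinaryTree Unit))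
    {t : BinaryTree Unit} (ht : t ≠ BinaryTree.nil) :
    (v ++ dirs p ++ ·) '' treeNodes t ∩ (v ++ ·) '' treeNodes (plug p leafTree) =
      {v ++ dirs p} := by
  have : (v ++ dirs p ++ ·) '' treeNodes t = (v ++ ·) '' ((dirs p ++ ·) '' treeNodes t) := by
    rw [Set.image_image]
    simp only [List.append_assoc]
  rw [this, ← Set.image_inter (append_left_injective' v), treeNodes_plug_inter p ht,
    Set.image_singleton]

/-- The host may itself supply what lies below an open cluster: take `x = t` in `DecomposesOpen`.
The lower cluster is the full subtree at the lower end of `p`. -/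
theorem decomposesClosed_vertical {A B : TopTree} {p : List (Bool × BinaryTree Unit)}
    {t : BinaryTree Unit} (hA : DecomposesClosed A t) (hB : DecomposesOpen B p) :
    DecomposesClosed (TopTree.vertical false A B) (plug p t) := by
  have ht := hA.1.ne_nil
  refine ⟨hasChild_plug hB.1 ht, fun T v h => ?_⟩
  have hs : subtreeAt T (v ++ dirs p) = t := by
    rw [subtreeAt_append, h.subtreeAt_dirs hB.1 ht]
  have hc := h.isCluster (plug_ne_nil ht)
  rw [← image_plug_union v p ht] at hc ⊢
  exact Decomposes.vertical A B _ _ (v ++ dirs p) v none none (hA.2 T _ (Or.inl hs.symm))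
    (hB.2 T v t hA.1 h) (image_plug_inter v p ht) hc

theorem decomposesOpen_vertical {A B : TopTree} {p q : List (Bool × BinaryTree Unit)}
    (hA : DecomposesOpen A q) (hB : DecomposesOpen B p) :
    DecomposesOpen (TopTree.vertical true A B) (p ++ q) := by
  have hne : p ++ q ≠ [] := by simp [hB.1]
  refine ⟨hne, fun T v x hx h => ?_⟩
  have hc := h.isCluster_plug hne hx
  rw [plug_append] at h
  have ht : HasChild (plug q x) := hasChild_plug hA.1 hx.ne_nil
  have hs : subtreeAt T (v ++ dirs p) = plug q x := by
    rw [subtreeAt_append, h.subtreeAt_dirs hB.1 ht.ne_nil]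
  have ht' : plug q leafTree ≠ BinaryTree.nil := plug_ne_nil leafTree_ne_nil
  have hd : v ++ dirs (p ++ q) = v ++ dirs p ++ dirs q := by simp [dirs]
  rw [hd] at hc ⊢
  rw [plug_append, ← image_plug_union v p ht'] at hc ⊢
  exact Decomposes.vertical A B _ _ (v ++ dirs p) v (some _) _
    (hA.2 T _ x hx (Or.inl hs.symm)) (hB.2 T v _ ht h) (image_plug_inter v p ht') hc

/-! ### Clusters built from a stock of top-trees -/

/-- The subtrees of `A` belong to the stock `F` and `A` has depth at most `D`. -/
def Available (F : Finset TopTree) (D : ℕ) (A : TopTree) : Prop := A.subtrees ⊆ F ∧ A.depth ≤ D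

/-- A closed cluster of shape `t` is available, unless `t` has no edges. -/
def OptClosed (F : Finset TopTree) (D : ℕ) (t : BinaryTree Unit) : Prop :=
  t = leafTree ∨ ∃ A, Available F D A ∧ DecomposesClosed A t

/-- The cluster of the path `p` is available, both with and without its lower end as the bottom
boundary node, unless the path is empty. -/
def Piece (F : Finset TopTree) (D : ℕ) (p : List (Bool × BinaryTree Unit)) : Prop :=
  p = [] ∨ ((∃ A, Available F D A ∧ DecomposesOpen A p) ∧
    ∃ A, Available F D A ∧ DecomposesClosed A (plug p leafTree))

/-- The clusters of the path `p` without its last edge are available. -/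
def Run (F : Finset TopTree) (D : ℕ) (p : List (Bool × BinaryTree Unit)) : Prop :=
  p = [] ∨ ∃ q d s, p = q ++ [(d, s)] ∧ Piece F D q ∧
    OptClosed F D (branch (!d) s BinaryTree.nil)

section Mono

variable {F F' : Finset TopTree} {D D' : ℕ}

theorem Available.mono {A : TopTree} (h : Available F D A) (hF : F ⊆ F') (hD : D ≤ D') :
    Available F' D' A := ⟨h.1.trans hF, h.2.trans hD⟩

theorem OptClosed.mono {t : BinaryTree Unit} (h : OptClosed F D t) (hF : F ⊆ F') (hD : D ≤ D') :
    OptClosed F' D' t := by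
  rcases h with h | ⟨A, hA, h⟩
  · exact Or.inl h
  · exact Or.inr ⟨A, hA.mono hF hD, h⟩

theorem Piece.mono {p : List (Bool × BinaryTree Unit)} (h : Piece F D p) (hF : F ⊆ F')
    (hD : D ≤ D') : Piece F' D' p := by
  rcases h with h | ⟨⟨A, hA, h⟩, B, hB, h'⟩
  · exact Or.inl h
  · exact Or.inr ⟨⟨A, hA.mono hF hD, h⟩, B, hB.mono hF hD, h'⟩

theorem Run.mono {p : List (Bool × BinaryTree Unit)} (h : Run F D p) (hF : F ⊆ F')
    (hD : D ≤ D') : Run F' D' p := by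
  rcases h with h | ⟨q, d, s, rfl, hq, hs⟩
  · exact Or.inl h
  · exact Or.inr ⟨q, d, s, rfl, hq.mono hF hD, hs.mono hF hD⟩

end Mono

theorem available_edge {F : Finset TopTree} (D : ℕ) (d : Bool) :
    Available (insert (TopTree.edge d) F) D (TopTree.edge d) :=
  ⟨by simp [TopTree.subtrees], by simp [TopTree.depth]⟩

theorem Available.horizontal {F F' : Finset TopTree} {D : ℕ} {A B : TopTree} {p q : Bool}
    (hA : Available F D A) (hB : Available F D B) (hF : F ⊆ F')
    (h : TopTree.horizontal p q A B ∈ F') :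
    Available F' (D + 1) (TopTree.horizontal p q A B) :=
  ⟨Finset.insert_subset h ((Finset.union_subset hA.1 hB.1).trans hF),
    Nat.succ_le_succ (max_le hA.2 hB.2)⟩

theorem Available.vertical {F F' : Finset TopTree} {D : ℕ} {A B : TopTree} {p : Bool}
    (hA : Available F D A) (hB : Available F D B) (hF : F ⊆ F')
    (h : TopTree.vertical p A B ∈ F') :
    Available F' (D + 1) (TopTree.vertical p A B) :=
  ⟨Finset.insert_subset h ((Finset.union_subset hA.1 hB.1).trans hF),
    Nat.succ_le_succ (max_le hA.2 hB.2)⟩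

/-! ### Cost accounting and merging of runs -/

/-- After adding at most `n` top-trees to the stock and increasing the depth by `e`, the
property `P` holds. -/
def Within (F : Finset TopTree) (D n e : ℕ) (P : Finset TopTree → ℕ → Prop) : Prop :=
  ∃ F', F ⊆ F' ∧ F'.card ≤ F.card + n ∧ P F' (D + e)

theorem Within.insert {F : Finset TopTree} {D n e : ℕ} {P : Finset TopTree → ℕ → Prop}
    {A : TopTree} (h : Within (insert A F) D n e P) : Within F D (n + 1) e P := by
  obtain ⟨F', h1, h2, h3⟩ := h
  refine ⟨F', (Finset.subset_insert _ _).trans h1, ?_, h3⟩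
  have := Finset.card_insert_le A F
  omega

/-- A path of a single edge, with both of its clusters. -/
theorem OptClosed.piece {F : Finset TopTree} {D : ℕ} {d : Bool} {s : BinaryTree Unit}
    (h : OptClosed F D (branch (!d) s BinaryTree.nil)) :
    Within F D 3 1 fun F D => Piece F D [(d, s)] := by
  rcases h with h | ⟨A, hA, h⟩
  · have hs : s = BinaryTree.nil := by
      rw [← branch_nil_nil (!d), branch_inj] at h
      exact h.1
    subst hs
    refine ⟨insert (TopTree.edge d) F, Finset.subset_insert _ _,
      (Finset.card_insert_le _ _).trans (by omega), Or.inr ⟨?_, ?_⟩⟩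
    · exact ⟨_, available_edge _ d, decomposesOpen_edge d⟩
    · exact ⟨_, available_edge _ d, decomposesClosed_edge d⟩
  · have he := available_edge (F := F) D d
    have hA' := hA.mono (Finset.subset_insert (TopTree.edge d) F) le_rfl
    set F1 := insert (TopTree.edge d) F
    have hF (X Y : TopTree) : F1 ⊆ insert X (insert Y F1) :=
      (Finset.subset_insert _ _).trans (Finset.subset_insert _ _)
    -- Horizontal merges list the left cluster first, so the direction of the edge decides the
    -- order. Together with the edge itself, the open and the closed merge make three additions.
    cases d
    · refine Within.insert (Within.insert (Within.insert
        ⟨insert (TopTree.horizontal true false (TopTree.edge false) A)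
          (insert (TopTree.horizontal false false (TopTree.edge false) A) F1),
          subset_rfl, le_rfl, Or.inr ⟨?_, ?_⟩⟩))
      · exact ⟨_, he.horizontal hA' (hF _ _) (by simp),
          decomposesOpen_horizontal_left (decomposesOpen_edge false) h⟩
      · exact ⟨_, he.horizontal hA' (hF _ _) (by simp),
          decomposesClosed_horizontal (decomposesClosed_edge false) h⟩
    · refine Within.insert (Within.insert (Within.insert
        ⟨insert (TopTree.horizontal false true A (TopTree.edge true))
          (insert (TopTree.horizontal false false A (TopTree.edge true)) F1),
          subset_rfl, le_rfl, Or.inr ⟨?_, ?_⟩⟩))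
      · exact ⟨_, hA'.horizontal he (hF _ _) (by simp),
          decomposesOpen_horizontal_right h (decomposesOpen_edge true)⟩
      · exact ⟨_, hA'.horizontal he (hF _ _) (by simp),
          decomposesClosed_horizontal h (decomposesClosed_edge true)⟩

theorem Within.bind {F : Finset TopTree} {D n e n' e' : ℕ} {P Q : Finset TopTree → ℕ → Prop}
    (h : Within F D n e P)
    (hPQ : ∀ F', F ⊆ F' → P F' (D + e) → Within F' (D + e) n' e' Q) :
    Within F D (n + n') (e + e') Q := by
  obtain ⟨F', h1, h2, h3⟩ := h
  obtain ⟨F'', h4, h5, h6⟩ := hPQ F' h1 h3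
  exact ⟨F'', h1.trans h4, by omega, by rwa [← add_assoc]⟩

theorem Within.pure {F : Finset TopTree} {D : ℕ} {P : Finset TopTree → ℕ → Prop} (h : P F D) :
    Within F D 0 0 P := ⟨F, subset_rfl, le_rfl, h⟩

theorem Within.mono {F : Finset TopTree} {D n e n' e' : ℕ} {P : Finset TopTree → ℕ → Prop}
    (h : Within F D n e P) (hP : ∀ F D D', D ≤ D' → P F D → P F D') (hn : n ≤ n')
    (he : e ≤ e') : Within F D n' e' P := by
  obtain ⟨F', h1, h2, h3⟩ := h
  exact ⟨F', h1, by omega, hP _ _ _ (by omega) h3⟩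

/-- One vertical merge for each version. The upper part always enters as an open cluster; the
version of `q` decides that of the result. -/
theorem Piece.append {F : Finset TopTree} {D : ℕ} {p q : List (Bool × BinaryTree Unit)}
    (hp : Piece F D p) (hq : Piece F D q) :
    Within F D 2 1 fun F D => Piece F D (p ++ q) := by
  rcases hq with rfl | ⟨⟨B, hB, hB'⟩, C, hC, hC'⟩
  · rw [List.append_nil]
    exact Within.mono (Within.pure hp) (fun F D D' h hP => hP.mono subset_rfl h) (by omega)
      (by omega)
  rcases hp with rfl | ⟨⟨A, hA, hA'⟩, -⟩
  · exact Within.mono (Within.pure (Or.inr ⟨⟨B, hB, hB'⟩, C, hC, hC'⟩))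
      (fun F D D' h hP => hP.mono subset_rfl h) (by omega) (by omega)
  have hF (X Y : TopTree) : F ⊆ insert X (insert Y F) :=
    (Finset.subset_insert _ _).trans (Finset.subset_insert _ _)
  refine Within.insert (Within.insert ⟨insert (TopTree.vertical true B A)
    (insert (TopTree.vertical false C A) F), subset_rfl, le_rfl, Or.inr ⟨?_, ?_⟩⟩)
  · exact ⟨_, hB.vertical hA (hF _ _) (by simp), decomposesOpen_vertical hB' hA'⟩
  · rw [plug_append]
    exact ⟨_, hC.vertical hA (hF _ _) (by simp), decomposesClosed_vertical hC' hA'⟩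

/-- The last edge of `p` becomes interior: it is completed to a piece (cost 3) and glued to the
pieces above and below it (cost 2 each), with one level of depth for each operation. The last edge
of `q` stays pending. -/
theorem Run.append {F : Finset TopTree} {D : ℕ} {p q : List (Bool × BinaryTree Unit)}
    (hp : Run F D p) (hq : Run F D q) :
    Within F D 7 3 fun F D => Run F D (p ++ q) := by
  have hmono : ∀ F D D', D ≤ D' → Run F D (p ++ q) → Run F D' (p ++ q) :=
    fun F D D' h hP => hP.mono subset_rfl h
  rcases hp with rfl | ⟨p, d, s, rfl, hp, hs⟩
  · exact Within.mono (Within.pure hq) hmono (by omega) (by omega)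
  rcases hq with rfl | ⟨q, e, t, rfl, hq, ht⟩
  · rw [List.append_nil]
    exact Within.mono (Within.pure (Or.inr ⟨p, d, s, rfl, hp, hs⟩))
      (fun F D D' h hP => hP.mono subset_rfl h) (by omega) (by omega)
  refine Within.mono (hs.piece.bind (n' := 4) (e' := 2) fun F1 hF1 h1 => ?_) hmono le_rfl le_rfl
  refine ((hp.mono hF1 (by omega)).append h1).bind (n' := 2) (e' := 1) fun F2 hF2 h2 => ?_
  refine (h2.append (hq.mono (hF1.trans hF2) (by omega))).bind (n' := 0) (e' := 0)
    fun F3 hF3 h3 => Within.pure (Or.inr ⟨_, e, t, ?_, h3, ?_⟩)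
  · simp
  · exact ht.mono (hF1.trans (hF2.trans hF3)) (by omega)

/-- Balanced concatenation of a list of runs. -/
theorem run_flatten (k : ℕ) {F : Finset TopTree} {D : ℕ}
    (ps : List (List (Bool × BinaryTree Unit))) (hlen : ps.length ≤ 2 ^ k)
    (h : ∀ p ∈ ps, Run F D p) :
    Within F D (7 * (ps.length - 1)) (3 * k) fun F D => Run F D ps.flatten := by
  induction k generalizing F ps with
  | zero =>
    match ps, hlen with
    | [], _ => exact Within.pure (Or.inl rfl)
    | [p], _ => exact Within.pure (by simpa using h)
  | succ k ih =>
    by_cases h0 : ps.length ≤ 1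
    · have h1 : 1 ≤ 2 ^ k := Nat.one_le_two_pow
      exact Within.mono (ih ps (h0.trans h1) h) (fun F D D' h hP => hP.mono subset_rfl h) le_rfl
        (by omega)
    · have h1 := ih (F := F) (ps.take (ps.length / 2))
        (by rw [List.length_take]; rw [pow_succ] at hlen; omega)
        fun p hp => h p (List.mem_of_mem_take hp)
      have hflat : ps.flatten = (ps.take (ps.length / 2)).flatten ++
          (ps.drop (ps.length / 2)).flatten := by
        rw [← List.flatten_append, List.take_append_drop]
      rw [hflat]
      -- The second half is built over the enlarged stock but from the original depth `D`. Its depth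
      -- increase is recorded as 0, so the two halves count in parallel; carrying `F1 ⊆ F'` keeps
      -- the first half available.
      refine Within.mono (n := 7 * ((ps.take (ps.length / 2)).length - 1) +
        (7 * (ps.length - ps.length / 2 - 1) + 7)) (e := 3 * k + (0 + 3))
        (h1.bind fun F1 hF1 h1 => Within.bind
        (P := fun F' D' => F1 ⊆ F' ∧ Run F' D' (ps.drop (ps.length / 2)).flatten) ?_
        fun F2 hF2 h2 => Run.append (h1.mono h2.1 (by omega)) h2.2)
        (fun F D D' h hP => hP.mono subset_rfl h) ?_ ?_
      · obtain ⟨F2, h2, h3, h4⟩ := ih (F := F1) (ps.drop (ps.length / 2))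
          (by rw [List.length_drop]; rw [pow_succ] at hlen; omega)
          fun p hp => (h p (List.mem_of_mem_drop hp)).mono hF1 le_rfl
        exact ⟨F2, h2, by simpa using h3, h2, h4⟩
      · rw [List.length_take]; omega
      · omega

/-- The cluster of a whole path, hanging from a new root. -/
theorem Run.optClosed {F : Finset TopTree} {D : ℕ} {p : List (Bool × BinaryTree Unit)}
    (hp : p ≠ []) (h : Run F D p) :
    Within F D 1 1 fun F D => OptClosed F D (plug p BinaryTree.nil) := by
  rcases h with rfl | ⟨q, d, s, rfl, hq, hs⟩
  · exact absurd rfl hp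
  rw [plug_append]
  simp only [plug]
  rw [← branch_not]
  have hmono : ∀ t F D D', D ≤ D' → OptClosed F D t → OptClosed F D' t :=
    fun t F D D' h hP => hP.mono subset_rfl h
  -- A merge is needed only if the path above and the subtree hanging at the last node both have
  -- edges. If only that subtree is trivial, the lower end is a leaf and the closed version of the
  -- path serves.
  rcases hq with rfl | ⟨⟨A, hA, hA'⟩, B, hB, hB'⟩
  · exact Within.mono (Within.pure hs) (hmono _) (by omega) (by omega)
  rcases hs with hs | ⟨C, hC, hC'⟩
  · rw [hs]
    exact Within.mono (Within.pure (Or.inr ⟨B, hB, hB'⟩)) (hmono _) (by omega) (by omega)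
  · exact Within.insert ⟨insert (TopTree.vertical false C A) F, subset_rfl, le_rfl,
      Or.inr ⟨_, hC.vertical hA (Finset.subset_insert _ _) (by simp),
        decomposesClosed_vertical hC' hA'⟩⟩

/-- The path tree of a list of runs, hanging from a new root in direction `d`. -/
theorem optClosed_flatten (k : ℕ) {F : Finset TopTree} {D : ℕ} (d : Bool)
    (ps : List (List (Bool × BinaryTree Unit))) (hlen : ps.length + 1 ≤ 2 ^ k)
    (h : ∀ p ∈ ps, Run F D p) :
    Within F D (7 * ps.length + 1) (3 * k + 1) fun F D =>
      OptClosed F D (branch d (plug ps.flatten BinaryTree.nil) BinaryTree.nil) := by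
  have h1 := run_flatten k (F := F) (D := D) ([(d, BinaryTree.nil)] :: ps) (by simpa using hlen)
    (by
      intro p hp
      rcases List.mem_cons.1 hp with rfl | hp
      · exact Or.inr ⟨[], d, BinaryTree.nil, rfl, Or.inl rfl, Or.inl (branch_nil_nil _)⟩
      · exact h p hp)
  exact h1.bind fun F' hF' h2 => h2.optClosed (by simp)

/-! ### Cartesian trees along the spines -/

section Cartesian

variable {α : Type*} [LinearOrder α]

theorem cartesianTree_nil : cartesianTree ([] : List α) = BinaryTree.nil := by
  rw [cartesianTree]; simp

/-- Strictness on the left and weak inequality on the right make `m` the first occurrence of the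
minimum. -/
theorem cartesianTree_append_cons {u w : List α} {m : α} (hu : ∀ x ∈ u, m < x)
    (hw : ∀ x ∈ w, m ≤ x) :
    cartesianTree (u ++ m :: w) = BinaryTree.node () (cartesianTree u) (cartesianTree w) := by
  have hne : u ++ m :: w ≠ [] := by simp
  have hmin : (u ++ m :: w).min hne = m := by
    apply le_antisymm
    · exact List.min_le_of_mem (by simp)
    · rcases List.mem_append.1 (List.min_mem hne) with h | h
      · exact (hu _ h).le
      · rcases List.mem_cons.1 h with h | h
        · exact h.ge
        · exact hw _ h
  have hidx : (u ++ m :: w).idxOf m = u.length := by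
    rw [List.idxOf_append_of_notMem fun h => lt_irrefl _ (hu m h)]
    simp
  rw [cartesianTree, dif_neg hne]
  simp [hmin, hidx]

/-- The string of a list of blocks, each consisting of a character followed by a string. -/
def flatL (l : List (α × List α)) : List α := l.flatMap fun b => b.1 :: b.2

/-- The string of a list of blocks, each consisting of a string followed by a character. -/
def flatR (r : List (α × List α)) : List α := r.flatMap fun b => b.2 ++ [b.1]

/-- The blocks start at the positions of the left spine of the Cartesian tree. -/
def IsLeftSpine (l : List (α × List α)) : Prop :=
  l.Pairwise (fun b b' => b'.1 < b.1) ∧ ∀ b ∈ l, ∀ x ∈ b.2, b.1 ≤ x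

/-- The blocks end at the positions of the right spine of the Cartesian tree. -/
def IsRightSpine (r : List (α × List α)) : Prop :=
  r.Pairwise (fun b b' => b.1 ≤ b'.1) ∧ ∀ b ∈ r, ∀ x ∈ b.2, b.1 < x

/-- The part of the left spine with character `c`. -/
def lpath (c : α) (l : List (α × List α)) : List (Bool × BinaryTree Unit) :=
  (l.filter fun b => b.1 = c).map fun b => (false, cartesianTree b.2)

/-- The part of the right spine with character `c`. -/
def rpath (c : α) (r : List (α × List α)) : List (Bool × BinaryTree Unit) :=
  (r.filter fun b => b.1 = c).map fun b => (true, cartesianTree b.2)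

/-- The path formed by the two spines, sorted by character. -/
def zigzag (cs : List α) (r l : List (α × List α)) : List (Bool × BinaryTree Unit) :=
  cs.flatMap fun c => rpath c r ++ lpath c l

theorem rpath_append (c : α) (r r' : List (α × List α)) :
    rpath c (r ++ r') = rpath c r ++ rpath c r' := by simp [rpath]

theorem lpath_append (c : α) (l l' : List (α × List α)) :
    lpath c (l ++ l') = lpath c l ++ lpath c l' := by simp [lpath]

theorem rpath_cons (c : α) (b : α × List α) (r : List (α × List α)) :
    rpath c (b :: r) = (if b.1 = c then [(true, cartesianTree b.2)] else []) ++ rpath c r := by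
  by_cases h : b.1 = c <;> simp [rpath, h]

theorem lpath_cons (c : α) (b : α × List α) (l : List (α × List α)) :
    lpath c (b :: l) = (if b.1 = c then [(false, cartesianTree b.2)] else []) ++ lpath c l := by
  by_cases h : b.1 = c <;> simp [lpath, h]

theorem rpath_eq_nil {c : α} {r : List (α × List α)} (h : ∀ b ∈ r, b.1 ≠ c) :
    rpath c r = [] := by
  simpa [rpath, List.filter_eq_nil_iff] using fun a b hb => h (a, b) hb

theorem lpath_eq_nil {c : α} {l : List (α × List α)} (h : ∀ b ∈ l, b.1 ≠ c) :
    lpath c l = [] := by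
  simpa [lpath, List.filter_eq_nil_iff] using fun a b hb => h (a, b) hb

theorem IsLeftSpine.le {l : List (α × List α)} (h : IsLeftSpine l) {m : α}
    (hm : ∀ b ∈ l, m ≤ b.1) {x : α} (hx : x ∈ flatL l) : m ≤ x := by
  obtain ⟨b, hb, hx⟩ := List.mem_flatMap.1 hx
  rcases List.mem_cons.1 hx with rfl | hx
  · exact hm b hb
  · exact (hm b hb).trans (h.2 b hb x hx)

theorem IsLeftSpine.lt {l : List (α × List α)} (h : IsLeftSpine l) {m : α}
    (hm : ∀ b ∈ l, m < b.1) {x : α} (hx : x ∈ flatL l) : m < x := by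
  obtain ⟨b, hb, hx⟩ := List.mem_flatMap.1 hx
  rcases List.mem_cons.1 hx with rfl | hx
  · exact hm b hb
  · exact (hm b hb).trans_le (h.2 b hb x hx)

theorem IsRightSpine.le {r : List (α × List α)} (h : IsRightSpine r) {m : α}
    (hm : ∀ b ∈ r, m ≤ b.1) {x : α} (hx : x ∈ flatR r) : m ≤ x := by
  obtain ⟨b, hb, hx⟩ := List.mem_flatMap.1 hx
  rcases List.mem_append.1 hx with hx | hx
  · exact (hm b hb).trans (h.2 b hb x hx).le
  · rw [List.mem_singleton.1 hx]
    exact hm b hb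

theorem IsRightSpine.lt {r : List (α × List α)} (h : IsRightSpine r) {m : α}
    (hm : ∀ b ∈ r, m < b.1) {x : α} (hx : x ∈ flatR r) : m < x := by
  obtain ⟨b, hb, hx⟩ := List.mem_flatMap.1 hx
  rcases List.mem_append.1 hx with hx | hx
  · exact (hm b hb).trans (h.2 b hb x hx)
  · rw [List.mem_singleton.1 hx]
    exact hm b hb

/-- Peel off the smallest character `c`. Its occurrences in `r` are the first blocks and become
roots one after another, each with its block as left subtree. Then `l` contributes at most its last
block, as a root with that block as right subtree. What remains uses only larger characters. Hence
in each group the run of `r` precedes that of `l`. -/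
theorem cartesianTree_flatR_append_flatL (cs : List α) (hcs : cs.Pairwise (· < ·))
    (r l : List (α × List α)) (hr : IsRightSpine r) (hl : IsLeftSpine l)
    (hrc : ∀ b ∈ r, b.1 ∈ cs) (hlc : ∀ b ∈ l, b.1 ∈ cs) :
    cartesianTree (flatR r ++ flatL l) = plug (zigzag cs r l) BinaryTree.nil := by
  induction cs generalizing r l with
  | nil =>
    have hr' : r = [] := List.eq_nil_iff_forall_not_mem.2 fun b hb => by simpa using hrc b hb
    have hl' : l = [] := List.eq_nil_iff_forall_not_mem.2 fun b hb => by simpa using hlc b hb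
    subst hr' hl'
    exact cartesianTree_nil
  | cons c cs ih =>
    obtain ⟨hc, hcs'⟩ := List.pairwise_cons.1 hcs
    have hmin : ∀ x ∈ c :: cs, c ≤ x := fun x hx => by
      rcases List.mem_cons.1 hx with rfl | hx
      · exact le_rfl
      · exact (hc x hx).le
    have hcne : ∀ c' ∈ cs, c ≠ c' := fun c' h => (hc c' h).ne
    have step : ∀ r l : List (α × List α), IsRightSpine r → IsLeftSpine l →
        (∀ b ∈ r, b.1 ∈ cs) → (∀ b ∈ l, b.1 ∈ cs) →
        cartesianTree (flatR r ++ flatL l) = plug (zigzag (c :: cs) r l) BinaryTree.nil := by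
      intro r l hr hl hrc hlc
      rw [ih hcs' r l hr hl hrc hlc, zigzag, zigzag, List.flatMap_cons,
        rpath_eq_nil fun b hb h => hcne _ (hrc b hb) h.symm,
        lpath_eq_nil fun b hb h => hcne _ (hlc b hb) h.symm]
      rfl
    have mem_cs : ∀ {x}, x ∈ c :: cs → c < x → x ∈ cs := fun hx h =>
      (List.mem_cons.1 hx).resolve_left h.ne'
    have stepL : ∀ r l : List (α × List α), IsRightSpine r → IsLeftSpine l →
        (∀ b ∈ r, b.1 ∈ cs) → (∀ b ∈ l, b.1 ∈ c :: cs) →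
        cartesianTree (flatR r ++ flatL l) = plug (zigzag (c :: cs) r l) BinaryTree.nil := by
      intro r l hr hl hrc hlc
      rcases List.eq_nil_or_concat l with rfl | ⟨l, ⟨a, u⟩, rfl⟩
      · exact step _ _ hr hl hrc (by simp)
      rw [List.concat_eq_append] at hl hlc ⊢
      have ha : ∀ b ∈ l, a < b.1 := fun b hb =>
        (List.pairwise_append.1 hl.1).2.2 b hb (a, u) (by simp)
      have hl' : IsLeftSpine l := ⟨(List.pairwise_append.1 hl.1).1, fun b hb =>
        hl.2 b (List.mem_append_left _ hb)⟩
      rcases (hmin a (hlc (a, u) (by simp))).eq_or_lt with rfl | hca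
      · have e1 : flatR r ++ flatL (l ++ [(c, u)]) = (flatR r ++ flatL l) ++ c :: u := by
          simp [flatL]
        have hlt : ∀ x ∈ flatR r ++ flatL l, c < x := by
          intro x hx
          rcases List.mem_append.1 hx with hx | hx
          · exact hr.lt (fun b hb => hc _ (hrc b hb)) hx
          · exact hl'.lt ha hx
        rw [e1, cartesianTree_append_cons hlt (hl.2 (c, u) (by simp)),
          ih hcs' r l hr hl' hrc
            fun b hb => mem_cs (hlc b (List.mem_append_left _ hb)) (ha b hb)]
        have h2 : zigzag (c :: cs) r (l ++ [(c, u)]) =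
            (false, cartesianTree u) :: zigzag cs r l := by
          rw [zigzag, List.flatMap_cons, lpath_append, lpath_eq_nil fun b hb => (ha b hb).ne',
            rpath_eq_nil fun b hb h => hcne _ (hrc b hb) h.symm, lpath_cons]
          simp only [if_true, lpath, List.filter_nil, List.map_nil, List.append_nil,
            List.nil_append, List.singleton_append, zigzag, List.cons.injEq, true_and]
          rw [List.flatMap_congr]
          intro c' hc'
          simp [hcne c' hc']
        rw [h2]
        rfl
      · refine step _ _ hr hl hrc fun b hb => mem_cs (hlc b hb) ?_
        rcases List.mem_append.1 hb with hb | hb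
        · exact hca.trans (ha b hb)
        · rw [List.mem_singleton.1 hb]; exact hca
    induction r with
    | nil => exact stepL _ _ hr hl (by simp) hlc
    | cons b r ihr =>
      obtain ⟨a, u⟩ := b
      have ha := (List.pairwise_cons.1 hr.1).1
      have hr' : IsRightSpine r := ⟨(List.pairwise_cons.1 hr.1).2, fun b hb =>
        hr.2 b (List.mem_cons_of_mem _ hb)⟩
      rcases (hmin a (hrc (a, u) (by simp))).eq_or_lt with rfl | hca
      · have h1 := ihr hr' fun b hb => hrc b (List.mem_cons_of_mem _ hb)
        have e1 : flatR ((c, u) :: r) ++ flatL l = u ++ c :: (flatR r ++ flatL l) := by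
          simp [flatR]
        rw [e1, cartesianTree_append_cons (hr.2 (c, u) (by simp)), h1]
        · have h2 : zigzag (c :: cs) ((c, u) :: r) l =
              (true, cartesianTree u) :: zigzag (c :: cs) r l := by
            rw [zigzag, List.flatMap_cons, rpath_cons, zigzag, List.flatMap_cons]
            simp only [if_true, List.cons_append, List.nil_append, List.append_assoc,
              List.cons.injEq, true_and]
            congr 2
            rw [List.flatMap_congr]
            intro c' hc'
            rw [rpath_cons, if_neg (hcne c' hc'), List.nil_append]
          rw [h2]
          rfl
        · intro x hx
          rcases List.mem_append.1 hx with hx | hx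
          · exact hr'.le ha hx
          · exact hl.le (fun b hb => hmin _ (hlc b hb)) hx
      · refine stepL _ _ hr hl (fun b hb => mem_cs (hrc b hb) ?_) hlc
        rcases List.mem_cons.1 hb with rfl | hb
        · exact hca
        · exact hca.trans_le (ha b hb)

end Cartesian

/-! ### Concatenation -/

section Concat

variable {α : Type*} [LinearOrder α]

/-- A condition on characters keeps or drops each run as a whole, so cutting a spine at a threshold
needs no new clusters. -/
theorem rpath_filter (c : α) (P : α → Prop) [DecidablePred P] (r : List (α × List α)) :
    rpath c (r.filter fun b => P b.1) = if P c then rpath c r else [] := by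
  induction r with
  | nil => simp [rpath]
  | cons b r ih =>
    by_cases hb : P b.1
    · rw [List.filter_cons_of_pos (by simpa using hb), rpath_cons, rpath_cons, ih]
      by_cases hbc : b.1 = c
      · subst hbc; simp [hb]
      · simp [hbc]
    · rw [List.filter_cons_of_neg (by simpa using hb), rpath_cons, ih]
      by_cases hbc : b.1 = c
      · subst hbc; simp [hb]
      · simp [hbc]

theorem lpath_filter (c : α) (P : α → Prop) [DecidablePred P] (l : List (α × List α)) :
    lpath c (l.filter fun b => P b.1) = if P c then lpath c l else [] := by
  induction l with
  | nil => simp [lpath]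
  | cons b l ih =>
    by_cases hb : P b.1
    · rw [List.filter_cons_of_pos (by simpa using hb), lpath_cons, lpath_cons, ih]
      by_cases hbc : b.1 = c
      · subst hbc; simp [hb]
      · simp [hbc]
    · rw [List.filter_cons_of_neg (by simpa using hb), lpath_cons, ih]
      by_cases hbc : b.1 = c
      · subst hbc; simp [hb]
      · simp [hbc]

theorem IsRightSpine.filter {r : List (α × List α)} (h : IsRightSpine r)
    (P : α × List α → Bool) : IsRightSpine (r.filter P) :=
  ⟨h.1.filter P, fun b hb => h.2 b (List.mem_of_mem_filter hb)⟩

theorem IsLeftSpine.filter {l : List (α × List α)} (h : IsLeftSpine l)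
    (P : α × List α → Bool) : IsLeftSpine (l.filter P) :=
  ⟨h.1.filter P, fun b hb => h.2 b (List.mem_of_mem_filter hb)⟩

/-- Characters are monotone along a spine, so the two filters are a prefix and the complementary
suffix. -/
theorem IsRightSpine.filter_append_filter {r : List (α × List α)} (h : IsRightSpine r) (m : α) :
    (r.filter fun b => b.1 ≤ m) ++ (r.filter fun b => m < b.1) = r := by
  induction r with
  | nil => rfl
  | cons b r ih =>
    have ih := ih ⟨(List.pairwise_cons.1 h.1).2, fun b hb => h.2 b (List.mem_cons_of_mem _ hb)⟩
    by_cases hb : b.1 ≤ m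
    · simpa [hb] using ih
    · have : ∀ b' ∈ r, m < b'.1 := fun b' hb' =>
        (not_le.1 hb).trans_le ((List.pairwise_cons.1 h.1).1 b' hb')
      rw [List.filter_eq_nil_iff.2, List.filter_eq_self.2, List.nil_append]
      · simpa [not_le.1 hb] using fun a u hb' => this (a, u) hb'
      · simpa [not_le.1 hb] using fun a u hb' => this (a, u) hb'

theorem IsLeftSpine.filter_append_filter {l : List (α × List α)} (h : IsLeftSpine l) (m : α) :
    (l.filter fun b => m ≤ b.1) ++ (l.filter fun b => b.1 < m) = l := by
  induction l with
  | nil => rfl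
  | cons b l ih =>
    have ih := ih ⟨(List.pairwise_cons.1 h.1).2, fun b hb => h.2 b (List.mem_cons_of_mem _ hb)⟩
    by_cases hb : m ≤ b.1
    · simpa [hb] using ih
    · have : ∀ b' ∈ l, b'.1 < m := fun b' hb' =>
        ((List.pairwise_cons.1 h.1).1 b' hb').trans (not_le.1 hb)
      rw [List.filter_eq_nil_iff.2, List.filter_eq_self.2, List.nil_append]
      · simpa [not_le.1 hb] using fun a u hb' => this (a, u) hb'
      · simpa [not_le.1 hb] using fun a u hb' => this (a, u) hb'

/-- The clusters along both spines of the Cartesian tree of `w` are available. -/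
def SpinesAvailable (F : Finset TopTree) (D : ℕ) (w : List α) : Prop :=
  ∃ l m r, w = flatL l ++ m :: flatR r ∧ IsLeftSpine l ∧ IsRightSpine r ∧
    (∀ b ∈ l, m < b.1) ∧ (∀ b ∈ r, m ≤ b.1) ∧
    (∀ c, Run F D (rpath c r)) ∧ ∀ c, Run F D (lpath c l)

theorem SpinesAvailable.mono {F F' : Finset TopTree} {D D' : ℕ} {w : List α}
    (h : SpinesAvailable F D w) (hF : F ⊆ F') (hD : D ≤ D') : SpinesAvailable F' D' w := by
  obtain ⟨l, m, r, h1, h2, h3, h4, h5, h6, h7⟩ := h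
  exact ⟨l, m, r, h1, h2, h3, h4, h5, fun c => (h6 c).mono hF hD, fun c => (h7 c).mono hF hD⟩

theorem spinesAvailable_singleton (F : Finset TopTree) (D : ℕ) (a : α) :
    SpinesAvailable F D [a] :=
  ⟨[], a, [], rfl, ⟨List.Pairwise.nil, by simp⟩, ⟨List.Pairwise.nil, by simp⟩, by simp, by simp,
    fun _ => Or.inl rfl, fun _ => Or.inl rfl⟩

end Concat

/-! ### Cost of one concatenation over an alphabet of size `σ` -/

section Finite

variable {σ : ℕ}

/-- The Cartesian tree of a right spine followed by a left spine, hanging from a new root. -/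
theorem optClosed_cartesianTree (k : ℕ) (hk : 2 * σ + 1 ≤ 2 ^ k) {F : Finset TopTree} {D : ℕ}
    (d : Bool) (r l : List (Fin σ × List (Fin σ))) (hr : IsRightSpine r) (hl : IsLeftSpine l)
    (hR : ∀ c, Run F D (rpath c r)) (hL : ∀ c, Run F D (lpath c l)) :
    Within F D (14 * σ + 1) (3 * k + 1) fun F D =>
      OptClosed F D (branch d (cartesianTree (flatR r ++ flatL l)) BinaryTree.nil) := by
  have hlen : ((List.finRange σ).flatMap fun c => [rpath c r, lpath c l]).length = 2 * σ := by
    simp [List.length_flatMap, mul_comm]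
  have hflat : ((List.finRange σ).flatMap fun c => [rpath c r, lpath c l]).flatten =
      zigzag (List.finRange σ) r l := by
    rw [zigzag]
    generalize List.finRange σ = cs
    induction cs with
    | nil => rfl
    | cons c cs ih => simp [List.flatMap_cons, ih]
  have h := optClosed_flatten k (F := F) (D := D) d
    ((List.finRange σ).flatMap fun c => [rpath c r, lpath c l]) (by rw [hlen]; exact hk) (by
      intro p hp
      obtain ⟨c, -, hp⟩ := List.mem_flatMap.1 hp
      rcases List.mem_cons.1 hp with rfl | hp
      · exact hR c
      · rw [List.mem_singleton.1 hp]; exact hL c)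
  rw [hlen, hflat, ← cartesianTree_flatR_append_flatL _ (List.pairwise_lt_finRange σ) r l hr hl
    (fun _ _ => List.mem_finRange _) fun _ _ => List.mem_finRange _] at h
  exact h.mono (fun F D D' h hP => hP.mono subset_rfl h) (by omega) le_rfl

/-- The root `a` and the left spine survive. The right spine keeps its entries `≤ b`, continues with
`b` and then with `rb`; the entries `> b`, together with `lb`, form the block `Z` hanging to the
left of `b`. Only the run of `b` has to be rebuilt. -/
theorem SpinesAvailable.append_of_le {F : Finset TopTree} {D k : ℕ} (hk : 2 * σ + 1 ≤ 2 ^ k)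
    {la ra lb rb : List (Fin σ × List (Fin σ))} {a b : Fin σ} (hab : a ≤ b)
    (hla : IsLeftSpine la) (hra : IsRightSpine ra) (hlb : IsLeftSpine lb) (hrb : IsRightSpine rb)
    (hal : ∀ x ∈ la, a < x.1) (har : ∀ x ∈ ra, a ≤ x.1)
    (hbl : ∀ x ∈ lb, b < x.1) (hbr : ∀ x ∈ rb, b ≤ x.1)
    (hRa : ∀ c, Run F D (rpath c ra)) (hLa : ∀ c, Run F D (lpath c la))
    (hRb : ∀ c, Run F D (rpath c rb)) (hLb : ∀ c, Run F D (lpath c lb)) :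
    Within F D (14 * σ + 15) (3 * k + 7) fun F D =>
      SpinesAvailable F D ((flatL la ++ a :: flatR ra) ++ (flatL lb ++ b :: flatR rb)) := by
  set ra' := ra.filter fun x => b < x.1 with hra'
  have h1 := optClosed_cartesianTree k hk (F := F) (D := D) false ra' lb (hra.filter _) hlb
    (fun c => by
      rw [hra', rpath_filter c (b < ·)]
      split_ifs
      · exact hRa c
      · exact Or.inl rfl) hLb
  set Z := flatR ra' ++ flatL lb with hZ
  have hZb : ∀ x ∈ Z, b < x := by
    intro x hx
    rcases List.mem_append.1 hx with hx | hx
    · exact (hra.filter _).lt (fun y hy => by simpa using List.of_mem_filter hy) hx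
    · exact hlb.lt hbl hx
  refine h1.bind (n' := 14) (e' := 6) fun F1 hF1 h1 => ?_
  have hrun : Run F1 (D + (3 * k + 1)) [(true, cartesianTree Z)] :=
    Or.inr ⟨[], true, _, rfl, Or.inl rfl, h1⟩
  -- Three runs fit under `2 ^ 2`, which gives the extra cost `7 * 2` and depth `3 * 2`.
  refine (run_flatten 2 [rpath b ra, [(true, cartesianTree Z)], rpath b rb] (by simp)
    ?_).bind (n' := 0) (e' := 0) fun F2 hF2 h2 => Within.pure ?_
  · simp only [List.mem_cons, List.not_mem_nil, or_false]
    rintro p (rfl | rfl | rfl)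
    · exact (hRa b).mono hF1 (by omega)
    · exact hrun
    · exact (hRb b).mono hF1 (by omega)
  refine ⟨la, a, (ra.filter fun x => x.1 ≤ b) ++ (b, Z) :: rb, ?_, hla, ⟨?_, ?_⟩, hal, ?_, ?_,
    fun c => (hLa c).mono (hF1.trans hF2) (by omega)⟩
  · nth_rewrite 1 [← hra.filter_append_filter b]
    simp [hZ, ← hra', flatR]
  · refine List.pairwise_append.2 ⟨hra.1.filter _, List.pairwise_cons.2 ⟨hbr, hrb.1⟩, ?_⟩
    intro x hx y hy
    have hx' : x.1 ≤ b := by simpa using List.of_mem_filter hx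
    rcases List.mem_cons.1 hy with rfl | hy
    · exact hx'
    · exact hx'.trans (hbr y hy)
  · intro x hx
    rcases List.mem_append.1 hx with hx | hx
    · exact hra.2 x (List.mem_of_mem_filter hx)
    · rcases List.mem_cons.1 hx with rfl | hx
      · exact hZb
      · exact hrb.2 x hx
  · intro x hx
    rcases List.mem_append.1 hx with hx | hx
    · exact har x (List.mem_of_mem_filter hx)
    · rcases List.mem_cons.1 hx with rfl | hx
      · exact hab
      · exact hab.trans (hbr x hx)
  · intro c
    rw [rpath_append, rpath_filter c (· ≤ b), rpath_cons]
    rcases lt_trichotomy c b with hc | rfl | hc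
    · rw [if_pos hc.le, if_neg hc.ne', List.nil_append,
        rpath_eq_nil fun x hx => (hc.trans_le (hbr x hx)).ne', List.append_nil]
      exact (hRa c).mono (hF1.trans hF2) (by omega)
    · rw [if_pos le_rfl, if_pos rfl]
      simpa using h2
    · rw [if_neg hc.not_ge, if_neg hc.ne, List.nil_append, List.nil_append]
      exact (hRb c).mono (hF1.trans hF2) (by omega)

/-- The root is now `b`, and its right spine is unchanged. On the left spine `a` shadows the entries
`≥ a` of `lb`, which move into the block `Z` to the right of `a`. By strict monotonicity `a` is
alone in its run, so no runs are joined and the stated bounds, chosen to match the other case, have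
slack. -/
theorem SpinesAvailable.append_of_lt {F : Finset TopTree} {D k : ℕ} (hk : 2 * σ + 1 ≤ 2 ^ k)
    {la ra lb rb : List (Fin σ × List (Fin σ))} {a b : Fin σ} (hab : b < a)
    (hla : IsLeftSpine la) (hra : IsRightSpine ra) (hlb : IsLeftSpine lb) (hrb : IsRightSpine rb)
    (hal : ∀ x ∈ la, a < x.1) (har : ∀ x ∈ ra, a ≤ x.1)
    (hbl : ∀ x ∈ lb, b < x.1) (hbr : ∀ x ∈ rb, b ≤ x.1)
    (hRa : ∀ c, Run F D (rpath c ra)) (hLa : ∀ c, Run F D (lpath c la))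
    (hRb : ∀ c, Run F D (rpath c rb)) (hLb : ∀ c, Run F D (lpath c lb)) :
    Within F D (14 * σ + 15) (3 * k + 7) fun F D =>
      SpinesAvailable F D ((flatL la ++ a :: flatR ra) ++ (flatL lb ++ b :: flatR rb)) := by
  set lb' := lb.filter fun x => a ≤ x.1 with hlb'
  have h1 := optClosed_cartesianTree k hk (F := F) (D := D) true ra lb' hra (hlb.filter _) hRa
    (fun c => by
      rw [hlb', lpath_filter c (a ≤ ·)]
      split_ifs
      · exact hLb c
      · exact Or.inl rfl)
  set Z := flatR ra ++ flatL lb' with hZ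
  have hZa : ∀ x ∈ Z, a ≤ x := by
    intro x hx
    rcases List.mem_append.1 hx with hx | hx
    · exact hra.le har hx
    · exact (hlb.filter _).le (fun y hy => by simpa using List.of_mem_filter hy) hx
  refine Within.mono (h1.bind (n' := 0) (e' := 0) fun F1 hF1 h1 => Within.pure ?_)
    (fun F D D' h hP => hP.mono subset_rfl h) (by omega) (by omega)
  have hrun : Run F1 (D + (3 * k + 1)) [(false, cartesianTree Z)] :=
    Or.inr ⟨[], false, _, rfl, Or.inl rfl, h1⟩
  have hlt : ∀ x ∈ lb.filter fun x => x.1 < a, x.1 < a := fun x hx => by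
    simpa using List.of_mem_filter hx
  refine ⟨la ++ (a, Z) :: (lb.filter fun x => x.1 < a), b, rb, ?_, ⟨?_, ?_⟩, hrb, ?_, hbr,
    fun c => (hRb c).mono hF1 (by omega), ?_⟩
  · nth_rewrite 1 [← hlb.filter_append_filter a]
    simp [hZ, ← hlb', flatL]
  · refine List.pairwise_append.2 ⟨hla.1, List.pairwise_cons.2 ⟨hlt, hlb.1.filter _⟩, ?_⟩
    intro x hx y hy
    rcases List.mem_cons.1 hy with rfl | hy
    · exact hal x hx
    · exact (hlt y hy).trans (hal x hx)
  · intro x hx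
    rcases List.mem_append.1 hx with hx | hx
    · exact hla.2 x hx
    · rcases List.mem_cons.1 hx with rfl | hx
      · exact hZa
      · exact hlb.2 x (List.mem_of_mem_filter hx)
  · intro x hx
    rcases List.mem_append.1 hx with hx | hx
    · exact hab.trans (hal x hx)
    · rcases List.mem_cons.1 hx with rfl | hx
      · exact hab
      · exact hbl x (List.mem_of_mem_filter hx)
  · intro c
    rw [lpath_append, lpath_cons, lpath_filter c (· < a)]
    rcases lt_trichotomy c a with hc | rfl | hc
    · rw [if_neg hc.ne', if_pos hc, lpath_eq_nil fun x hx => (hc.trans (hal x hx)).ne']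
      exact (hLb c).mono hF1 (by omega)
    · rw [if_pos rfl, if_neg (lt_irrefl _), lpath_eq_nil fun x hx => (hal x hx).ne']
      exact hrun
    · rw [if_neg hc.ne, if_neg hc.not_gt, List.append_nil, List.append_nil]
      exact (hLa c).mono hF1 (by omega)

theorem SpinesAvailable.append {F : Finset TopTree} {D k : ℕ} (hk : 2 * σ + 1 ≤ 2 ^ k)
    {u w : List (Fin σ)} (hu : SpinesAvailable F D u) (hw : SpinesAvailable F D w) :
    Within F D (14 * σ + 15) (3 * k + 7) fun F D => SpinesAvailable F D (u ++ w) := by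
  obtain ⟨la, a, ra, rfl, hla, hra, hal, har, hRa, hLa⟩ := hu
  obtain ⟨lb, b, rb, rfl, hlb, hrb, hbl, hbr, hRb, hLb⟩ := hw
  rcases le_or_gt a b with h | h
  · exact append_of_le hk h hla hra hlb hrb hal har hbl hbr hRa hLa hRb hLb
  · exact append_of_lt hk h hla hra hlb hrb hal har hbl hbr hRa hLa hRb hLb

/-- A top-tree of the whole Cartesian tree. -/
theorem SpinesAvailable.exists_closed {F : Finset TopTree} {D k : ℕ} (hk : 2 * σ + 1 ≤ 2 ^ k)
    {w : List (Fin σ)} (h : SpinesAvailable F D w) :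
    Within F D (28 * σ + 3) (6 * k + 3) fun F D => OptClosed F D (cartesianTree w) := by
  obtain ⟨l, m, r, rfl, hl, hr, hml, hmr, hR, hL⟩ := h
  have hT : cartesianTree (flatL l ++ m :: flatR r) =
      branch false (cartesianTree (flatL l)) (cartesianTree (flatR r)) :=
    cartesianTree_append_cons (fun x => hl.lt hml) (fun x => hr.le hmr)
  rw [hT]
  have hnil : ∀ c : Fin σ, ∀ F D, Run F D (lpath c []) ∧ Run F D (rpath c []) :=
    fun c F D => ⟨Or.inl rfl, Or.inl rfl⟩
  have h1 := optClosed_cartesianTree k hk (F := F) (D := D) false [] l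
    ⟨List.Pairwise.nil, by simp⟩ hl (fun c => (hnil c _ _).2) hL
  refine Within.mono (h1.bind (n' := 14 * σ + 2) (e' := 3 * k + 2) fun F1 hF1 h1 => ?_)
    (fun F D D' h hP => hP.mono subset_rfl h) (by omega) (by omega)
  have h2 := optClosed_cartesianTree k hk (F := F1) (D := D + (3 * k + 1)) true r []
    hr ⟨List.Pairwise.nil, by simp⟩ (fun c => (hR c).mono hF1 (by omega))
    (fun c => (hnil c _ _).1)
  refine Within.bind (n := 14 * σ + 1) (e := 3 * k + 1) (n' := 1) (e' := 1)
    (P := fun F' D' => F1 ⊆ F' ∧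
      OptClosed F' D' (branch true (cartesianTree (flatR r)) BinaryTree.nil)) ?_
    fun F2 hF2 h2 => ?_
  · obtain ⟨F2, h3, h4, h5⟩ := h2
    exact ⟨F2, h3, h4, h3, by simpa [flatL] using h5⟩
  have hmono : ∀ t F D D', D ≤ D' → OptClosed F D t → OptClosed F D' t :=
    fun t F D D' h hP => hP.mono subset_rfl h
  have h1 : OptClosed F2 (D + (3 * k + 1) + (3 * k + 1))
      (branch false (cartesianTree (flatL l)) BinaryTree.nil) := by
    simpa [flatR] using h1.mono h2.1 (Nat.le_add_right _ (3 * k + 1))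
  -- If one side is empty, the cluster of the other, which already contains the root, is the whole
  -- tree.
  rcases h2.2 with h3 | ⟨B, hB, hB'⟩
  · rw [← branch_nil_nil true, branch_inj] at h3
    rw [h3.1]
    exact Within.mono (Within.pure h1) (hmono _) (by omega) (by omega)
  rcases h1 with h1 | ⟨A, hA, hA'⟩
  · rw [← branch_nil_nil false, branch_inj] at h1
    rw [h1.1, ← branch_not, Bool.not_false]
    exact Within.mono (Within.pure h2.2) (hmono _) (by omega) (by omega)
  · exact Within.insert ⟨insert (TopTree.horizontal false false A B) F2, subset_rfl, le_rfl,
      Or.inr ⟨_, hA.horizontal hB (Finset.subset_insert _ _) (by simp),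
        decomposesClosed_horizontal hA' hB'⟩⟩

/-! ### Straight-line programs -/

theorem SLP.height_pos {α : Type*} (G : SLP α) (i : Fin G.size) : 1 ≤ G.height i := by
  rw [SLP.height]
  split
  · exact le_rfl
  · exact Nat.le_add_left _ _

/-- The spines of all variables of a straight-line program can be made available together. -/
theorem SLP.exists_stock (G : SLP (Fin σ)) {k : ℕ} (hk : 2 * σ + 1 ≤ 2 ^ k) (n : ℕ)
    (hn : n ≤ G.size) :
    ∃ F : Finset TopTree, F.card ≤ (14 * σ + 15) * n ∧ ∀ i : Fin G.size, i.val < n →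
      SpinesAvailable F ((3 * k + 7) * G.height i) (G.word i) := by
  induction n with
  | zero => exact ⟨∅, by simp, fun i hi => absurd hi (Nat.not_lt_zero _)⟩
  | succ n ih =>
    obtain ⟨F, hF, h⟩ := ih (by omega)
    set i : Fin G.size := ⟨n, hn⟩ with hi
    -- Variables are treated in topological order over one growing stock. The depth bound for a
    -- variable refers only to its two constituents, so it follows the height and not the number of
    -- rules processed.
    suffices hs : ∃ F', F ⊆ F' ∧ F'.card ≤ F.card + (14 * σ + 15) ∧
        SpinesAvailable F' ((3 * k + 7) * G.height i) (G.word i) by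
      obtain ⟨F', h1, h2, h3⟩ := hs
      refine ⟨F', (h2.trans (Nat.add_le_add_right hF _)).trans (by rw [mul_add, mul_one]),
        fun j hj => ?_⟩
      rcases Nat.lt_succ_iff_lt_or_eq.1 hj with hj | hj
      · exact (h j hj).mono h1 le_rfl
      · have : j = i := Fin.ext hj
        rwa [this]
    rw [SLP.word, SLP.height]
    split
    · exact ⟨F, subset_rfl, Nat.le_add_right _ _, spinesAvailable_singleton _ _ _⟩
    · rename_i a b hab
      have hlt := G.acyclic i a b hab
      rw [mul_add, mul_one]
      exact SpinesAvailable.append hk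
        ((h a hlt.1).mono subset_rfl (Nat.mul_le_mul_left _ (le_max_left _ _)))
        ((h b hlt.2).mono subset_rfl (Nat.mul_le_mul_left _ (le_max_right _ _)))

end Finite

/-! ### Degenerate trees and the final constants -/

theorem cartesianTree_length_le_one {α : Type*} [LinearOrder α] {w : List α}
    (h : cartesianTree w = leafTree) : w.length ≤ 1 := by
  have hnil : ∀ w : List α, cartesianTree w = BinaryTree.nil → w = [] := by
    intro w hw
    by_contra hne
    rw [cartesianTree, dif_neg hne] at hw
    simp at hw
  by_cases hne : w = []
  · simp [hne]
  rw [cartesianTree, dif_neg hne] at h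
  simp only [leafTree, BinaryTree.node.injEq, true_and] at h
  have h1 := hnil _ h.1
  have h2 := hnil _ h.2
  have := List.length_pos_iff.2 hne
  simp only [List.take_eq_nil_iff, hne, or_false] at h1
  rw [h1, zero_add, List.drop_eq_nil_iff] at h2
  exact h2

theorem DecomposesClosed.isTopTreeOf {A : TopTree} {t : BinaryTree Unit}
    (h : DecomposesClosed A t) : A.IsTopTreeOf t := by
  have h1 : subtreeAt t [] = t := by cases t <;> rfl
  simpa [TopTree.IsTopTreeOf] using h.2 t [] (Or.inl h1.symm)

theorem theorem3 :
    ∃ C : ℝ, 0 < C ∧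
      ∀ (σ : ℕ), 2 ≤ σ →
      ∀ (S : List (Fin σ)), 2 ≤ S.length →
      ∀ (G : SLP (Fin σ)), G.Generates S →
        ∃ 𝒯 : TopTree, 𝒯.IsTopTreeOf (cartesianTree S) ∧
          (𝒯.dagSize : ℝ) ≤ C * ((G.size : ℝ) * (σ : ℝ)) ∧
          (𝒯.depth : ℝ) ≤ C * ((G.depth : ℝ) * Real.log (σ : ℝ)) := by
  -- The factor 100 generously covers both integer bounds. Division by `Real.log 2` converts the
  -- binary logarithm, and only helps the size bound since `Real.log 2 < 1`.
  refine ⟨100 / Real.log 2, by positivity, fun σ hσ S hS G hG => ?_⟩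
  set L := Nat.log 2 σ with hL
  have hk : 2 * σ + 1 ≤ 2 ^ (L + 3) := by
    have := Nat.lt_pow_succ_log_self (b := 2) (by norm_num) σ
    rw [← hL, pow_succ] at this
    rw [pow_add]
    omega
  -- This lets the additive constants in the depth bound be absorbed into a multiple of `L`.
  have hL1 : 1 ≤ L := Nat.log_pos (by norm_num) hσ
  obtain ⟨F, hF, h⟩ := G.exists_stock hk G.size le_rfl
  obtain ⟨F', -, hF', h'⟩ := (h G.start G.start.2).exists_closed hk
  rw [show G.word G.start = S from hG] at h'
  -- A tree without edges has no top-tree; length at least 2 rules it out.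
  rcases h' with h' | ⟨A, hA, hA'⟩
  · have := cartesianTree_length_le_one h'
    omega
  refine ⟨A, hA'.isTopTreeOf, ?_, ?_⟩
  · have h1 : A.dagSize ≤ 100 * (G.size * σ) := by
      have h2 : A.dagSize ≤ F'.card := Finset.card_le_card hA.1
      have h3 : 1 ≤ G.size := G.start.pos
      have h4 : A.dagSize ≤ (14 * σ + 15) * G.size + (28 * σ + 3) := by omega
      nlinarith
    have h2 : (A.dagSize : ℝ) ≤ 100 * ((G.size : ℝ) * σ) := by exact_mod_cast h1
    refine h2.trans (mul_le_mul_of_nonneg_right ?_ (by positivity))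
    rw [le_div_iff₀ (Real.log_pos one_lt_two)]
    linarith [Real.log_two_lt_d9]
  · have h1 : A.depth ≤ 100 * (G.depth * L) := by
      have h2 : 1 ≤ G.depth := G.height_pos G.start
      have h3 : A.depth ≤ (3 * (L + 3) + 7) * G.depth + (6 * (L + 3) + 3) := hA.2
      nlinarith
    have h2 : (A.depth : ℝ) ≤ 100 * ((G.depth : ℝ) * L) := by exact_mod_cast h1
    have h3 : (L : ℝ) ≤ Real.log σ / Real.log 2 := Real.natLog_le_logb σ 2
    calc (A.depth : ℝ) ≤ 100 * ((G.depth : ℝ) * L) := h2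
      _ ≤ 100 * ((G.depth : ℝ) * (Real.log σ / Real.log 2)) := by gcongr
      _ = 100 / Real.log 2 * ((G.depth : ℝ) * Real.log σ) := by ring
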